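/- Let $(M,g)$ be an $(n+1)$-dimensional spacetime, i.e. a smooth manifold with a smooth Lorentzian metric $g_{\mu\nu}$ of signature $(-,+,\dots,+)$ and Levi-Civita connection $\nabla$. Suppose that $(M,g)$ admits a spacetime convex function: a smooth function $f:M\to\mathbb R$ whose Hessian $\nabla_\mu\nabla_\nu f$ has Lorentzian signature at every point and for which there is a constant $c>0$ with $V^\mu V^\nu\nabla_\mu\nabla_\nu f\ge c\,g_{\mu\nu}V^\mu V^\nu$ for all $V\in TM$. Let $\Sigma\subset M$ be a smoothly embedded spacelike hypersurface with induced Riemannian metric $h_{ij}$, and suppose that $\Sigma$ is time-symmetric, i.e. its second fundamental form $K_{ij}$ with respect to unit timelike normals vanishes identically. Then: 1. $(\Sigma,h)$ contains no closed geodesic, i.e. there is no nonconstant periodic smooth solution $\gamma:\mathbb R\to\Sigma$ of the geodesic equation of $h$; 2. $(\Sigma,h)$ contains no closed minimal two-surface, i.e. there is no nonempty compact smooth two-dimensional manifold $S$ without boundary with a smooth immersion $S\to\Sigma$ (in particular, no embedded such $S\subset\Sigma$) such that for every normal vector $\nu$ of $S$ in $\Sigma$ the second fundamental form $H_{pq}$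 in the direction $\nu$ satisfies $k^{pq}H_{pq}=0$, where $k_{pq}$ is the metric induced on $S$ by $h$. -/

import Mathlib

set_option maxSynthPendingDepth 3

open Set Topology
open scoped Manifold ContDiff

noncomputable section

namespace SpacetimeConvexity

section Algebra

variable {V : Type*} [AddCommGroup V] [Module ℝ V] [TopologicalSpace V]

/-- The bilinear form `b` on `V` has signature `(-,+,…,+)`: its quadratic form has index one and
is nondegenerate. -/
def HasLorentzianSignature (b : V →L[ℝ] V →L[ℝ] ℝ) : Prop :=
  let Q : QuadraticForm ℝ V :=
    LinearMap.BilinMap.toQuadraticMap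
      (LinearMap.mk₂ ℝ (fun u v => b u v) (by simp) (by simp) (by simp) (by simp))
  sigNeg Q = 1 ∧ sigPos Q + 1 = Module.finrank ℝ V

/-- The trace `k^{pq} B_{pq}` of a bilinear form `B` with respect to a nondegenerate
form `k`, i.e. the trace of the endomorphism `k⁻¹ ∘ B` of `V`. -/
def metricTrace (k B : V →L[ℝ] V →L[ℝ] ℝ) : ℝ :=
  LinearMap.trace ℝ V ((k.inverse.comp B : V →L[ℝ] V) : V →ₗ[ℝ] V)

/-- For a trilinear form `D`, the trilinear form
`(u, v, w) ↦ ½ (D(u, v, w) + D(v, u, w) - D(w, u, v))`. -/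
def koszul {E : Type*} [NormedAddCommGroup E] [NormedSpace ℝ E]
    (D : E →L[ℝ] E →L[ℝ] E →L[ℝ] ℝ) : E →L[ℝ] E →L[ℝ] E →L[ℝ] ℝ :=
  let swap : (E →L[ℝ] E →L[ℝ] ℝ) →L[ℝ] (E →L[ℝ] E →L[ℝ] ℝ) :=
    (ContinuousLinearMap.flipₗᵢ ℝ E E ℝ).toContinuousLinearEquiv
  (1 / 2 : ℝ) • (D + D.flip - swap.comp D.flip)

theorem koszul_apply {E : Type*} [NormedAddCommGroup E] [NormedSpace ℝ E]
    (D : E →L[ℝ] E →L[ℝ] E →L[ℝ] ℝ) (u v w : E) :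
    koszul D u v w = (1 / 2) * (D u v w + D v u w - D w u v) := by
  simp [koszul]

end Algebra

/-- A field of bilinear forms on the tangent spaces of an `m`-dimensional manifold. -/
abbrev BilinField (m : ℕ) (M : Type*) [TopologicalSpace M]
    [ChartedSpace (EuclideanSpace ℝ (Fin m)) M] : Type _ :=
  (p : M) → TangentSpace (𝓡 m) p →L[ℝ] TangentSpace (𝓡 m) p →L[ℝ] ℝ

section Manifolds

variable {m : ℕ} {M : Type*} [TopologicalSpace M] [ChartedSpace (EuclideanSpace ℝ (Fin m)) M]
variable {k : ℕ} {N : Type*} [TopologicalSpace N] [ChartedSpace (EuclideanSpace ℝ (Fin k)) N]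

/-- `g` is a smooth Lorentzian metric: a smooth symmetric covariant 2-tensor field which has
signature `(-,+,…,+)` at every point. -/
structure IsLorentzianMetric (g : BilinField m M) [IsManifold (𝓡 m) ∞ M] : Prop where
  contMDiff : ContMDiff (𝓡 m)
    ((𝓡 m).prod 𝓘(ℝ, EuclideanSpace ℝ (Fin m) →L[ℝ] EuclideanSpace ℝ (Fin m) →L[ℝ] ℝ)) ∞
    (fun p => Bundle.TotalSpace.mk'
      (EuclideanSpace ℝ (Fin m) →L[ℝ] EuclideanSpace ℝ (Fin m) →L[ℝ] ℝ)
      (E := fun p : M => TangentSpace (𝓡 m) p →L[ℝ] TangentSpace (𝓡 m) p →L[ℝ] ℝ) p (g p))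
  symm : ∀ (p : M) (u v : TangentSpace (𝓡 m) p), g p u v = g p v u
  signature : ∀ p : M, HasLorentzianSignature (g p)

/-- The pullback `F^* g` of a field of bilinear forms. -/
def pullback (g : BilinField m M) (F : N → M) : BilinField k N := fun x =>
  ((ContinuousLinearMap.precomp ℝ (mfderiv (𝓡 k) (𝓡 m) F x)).comp (g (F x))).comp
    (mfderiv (𝓡 k) (𝓡 m) F x)

/-- The field `h` is positive definite at every point. -/
def IsPositiveDefinite (h : BilinField k N) : Prop :=
  ∀ (x : N) (u : TangentSpace (𝓡 k) x), u ≠ 0 → 0 < h x u u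

/-- The components `g_{μν}(y)` of `g` in the preferred chart `φ` around `p`, as a function of the
coordinates `y`: the pullback of `g` by `φ⁻¹`. -/
def metricInChart (g : BilinField m M) (p : M) (y : EuclideanSpace ℝ (Fin m)) :
    EuclideanSpace ℝ (Fin m) →L[ℝ] EuclideanSpace ℝ (Fin m) →L[ℝ] ℝ :=
  let q : M := (extChartAt (𝓡 m) p).symm y
  let A : EuclideanSpace ℝ (Fin m) →L[ℝ] TangentSpace (𝓡 m) q :=
    mfderiv (𝓡 m) (𝓡 m) (extChartAt (𝓡 m) p).symm y
  ((ContinuousLinearMap.precomp ℝ A).comp (g q)).comp A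

/-- The Christoffel symbols of the first kind at `p`, in the preferred chart around `p`:
`(u, v, w) ↦ ½ (∂_u g(v, w) + ∂_v g(u, w) - ∂_w g(u, v))`. -/
def christoffelFirst (g : BilinField m M) (p : M) :
    EuclideanSpace ℝ (Fin m) →L[ℝ] EuclideanSpace ℝ (Fin m) →L[ℝ]
      EuclideanSpace ℝ (Fin m) →L[ℝ] ℝ :=
  koszul (fderiv ℝ (metricInChart g p) (extChartAt (𝓡 m) p p))

/-- The Christoffel symbols `Γ^λ_{μν}` at `p` of the Levi-Civita connection of `g`, in the preferred
chart around `p` (the index of `christoffelFirst` is raised with the inverse metric). -/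
def christoffel (g : BilinField m M) (p : M) :
    EuclideanSpace ℝ (Fin m) →L[ℝ] EuclideanSpace ℝ (Fin m) →L[ℝ] EuclideanSpace ℝ (Fin m) :=
  (ContinuousLinearMap.postcomp (EuclideanSpace ℝ (Fin m))
    (metricInChart g p (extChartAt (𝓡 m) p p)).inverse).comp (christoffelFirst g p)

theorem christoffel_apply (g : BilinField m M) (p : M) (u v : EuclideanSpace ℝ (Fin m)) :
    christoffel g p u v =
      (metricInChart g p (extChartAt (𝓡 m) p p)).inverse (christoffelFirst g p u v) := rfl

/-- The Hessian `∇_μ∇_ν f = ∂_μ∂_ν f - Γ^λ_{μν} ∂_λ f` of `f` at `p` with respect to `g`. It is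
computed in the preferred chart around `p`, through which `TangentSpace (𝓡 m) p` is
identified with the model space. -/
def hessian (g : BilinField m M) (f : M → ℝ) : BilinField m M := fun p =>
  let y := extChartAt (𝓡 m) p p
  let fhat : EuclideanSpace ℝ (Fin m) → ℝ := f ∘ (extChartAt (𝓡 m) p).symm
  (fderiv ℝ (fderiv ℝ fhat) y
    - (ContinuousLinearMap.postcomp (EuclideanSpace ℝ (Fin m)) (fderiv ℝ fhat y)).comp
        (christoffel g p) :
    EuclideanSpace ℝ (Fin m) →L[ℝ] EuclideanSpace ℝ (Fin m) →L[ℝ] ℝ)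

/-- `f` is a spacetime convex function on `(M, g)`: it is smooth, its Hessian has
Lorentzian signature, and `∇_μ∇_ν f ≥ c g_{μν}` for a positive constant `c`. -/
structure IsSpacetimeConvex (g : BilinField m M) (f : M → ℝ) : Prop where
  contMDiff : ContMDiff (𝓡 m) 𝓘(ℝ, ℝ) ∞ f
  signature : ∀ p : M, HasLorentzianSignature (hessian g f p)
  bound : ∃ c : ℝ, 0 < c ∧
    ∀ (p : M) (V : TangentSpace (𝓡 m) p), c * g p V V ≤ hessian g f p V V

/-- `ξ` is normal at `F x` to the image of `F : N → M`. -/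
def IsNormal (g : BilinField m M) (F : N → M) (x : N) (ξ : TangentSpace (𝓡 m) (F x)) : Prop :=
  ∀ u : TangentSpace (𝓡 k) x, g (F x) ξ (mfderiv (𝓡 k) (𝓡 m) F x u) = 0

/-- The covariant derivative `∇_u (dF v) = ∂_u ∂_v F + Γ(dF u, dF v)` at `x`, where `v` is extended
with constant components in the preferred chart around `x`. -/
def covDerivDifferential (g : BilinField m M) (F : N → M) (x : N) :
    EuclideanSpace ℝ (Fin k) →L[ℝ] EuclideanSpace ℝ (Fin k) →L[ℝ] EuclideanSpace ℝ (Fin m) :=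
  let y := extChartAt (𝓡 k) x x
  let Fhat : EuclideanSpace ℝ (Fin k) → EuclideanSpace ℝ (Fin m) :=
    extChartAt (𝓡 m) (F x) ∘ F ∘ (extChartAt (𝓡 k) x).symm
  fderiv ℝ (fderiv ℝ Fhat) y
    + ((ContinuousLinearMap.precomp (EuclideanSpace ℝ (Fin m)) (fderiv ℝ Fhat y)).comp
        (christoffel g (F x))).comp (fderiv ℝ Fhat y)

/-- The second fundamental form of `F : N → M` at `x` in the direction of the normal
vector `ξ`: `(u, v) ↦ g(ξ, ∇_u (dF v))`. Since `ξ` is normal, the way in which `v` is extended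
does not matter. -/
def secondFundamentalForm (g : BilinField m M) (F : N → M) (x : N)
    (ξ : TangentSpace (𝓡 m) (F x)) :
    TangentSpace (𝓡 k) x →L[ℝ] TangentSpace (𝓡 k) x →L[ℝ] ℝ :=
  ((ContinuousLinearMap.postcomp (EuclideanSpace ℝ (Fin k))
      (g (F x) ξ : EuclideanSpace ℝ (Fin m) →L[ℝ] ℝ)).comp (covDerivDifferential g F x) :
    EuclideanSpace ℝ (Fin k) →L[ℝ] EuclideanSpace ℝ (Fin k) →L[ℝ] ℝ)

/-- The embedding `ι` is smooth, and its image is a spacelike submanifold of `(M, g)`: the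
induced metric is positive definite. -/
structure IsSpacelikeEmbedding (g : BilinField m M) (ι : N → M) : Prop where
  isSmoothEmbedding : Manifold.IsSmoothEmbedding (𝓡 k) (𝓡 m) ∞ ι
  isPositiveDefinite : IsPositiveDefinite (k := k) (pullback g ι)

/-- The hypersurface `ι` is time-symmetric: its second fundamental form `K_{ij}` with respect to
unit timelike normals vanishes. -/
def IsTimeSymmetric (g : BilinField m M) (ι : N → M) : Prop :=
  ∀ (x : N) (t : TangentSpace (𝓡 m) (ι x)),
    IsNormal (k := k) g ι x t → g (ι x) t t = -1 →
      secondFundamentalForm (k := k) g ι x t = 0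

/-- `γ` is a closed geodesic of `(N, h)`: a smooth, periodic, nonconstant solution of the geodesic
equation `γ'' + Γ(γ', γ') = 0`. At the parameter value `t` the equation is written in the preferred
chart around `γ t`. -/
structure IsClosedGeodesic (h : BilinField k N) (γ : ℝ → N) : Prop where
  contMDiff : ContMDiff 𝓘(ℝ, ℝ) (𝓡 k) ∞ γ
  geodesic : ∀ t : ℝ,
    let c : ℝ → EuclideanSpace ℝ (Fin k) := fun s => extChartAt (𝓡 k) (γ t) (γ s)
    deriv (deriv c) t + christoffel h (γ t) (deriv c t) (deriv c t) = 0
  periodic : ∃ T : ℝ, 0 < T ∧ Function.Periodic γ T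
  nonconstant : ∃ s t : ℝ, γ s ≠ γ t

end Manifolds

section Minimal

variable {k : ℕ} {N : Type*} [TopologicalSpace N] [ChartedSpace (EuclideanSpace ℝ (Fin k)) N]
variable {d : ℕ} {S : Type*} [TopologicalSpace S] [ChartedSpace (EuclideanSpace ℝ (Fin d)) S]

/-- `j : S → N` is a minimal (immersed) submanifold of the Riemannian manifold `(N, h)`: it is a
smooth immersion, and for every normal `ν` the trace `k^{pq} H_{pq}` of the second fundamental form
with respect to the metric induced on `S` vanishes. -/
structure IsMinimalImmersion (h : BilinField k N) (j : S → N) : Prop where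
  contMDiff : ContMDiff (𝓡 d) (𝓡 k) ∞ j
  injective_mfderiv : ∀ s : S, Function.Injective (mfderiv (𝓡 d) (𝓡 k) j s)
  minimal : ∀ (s : S) (ν : TangentSpace (𝓡 k) (j s)), IsNormal (k := d) h j s ν →
    metricTrace (pullback (k := d) h j s) (secondFundamentalForm (k := d) h j s ν) = 0

end Minimal

end SpacetimeConvexity

end

/-! The restriction of `f` to the hypersurface is strictly convex, and a strictly convex function
rules out both kinds of closed object. Vanishing of `K` makes the hypersurface totally geodesic:
`∇_u (dι v)` is orthogonal to every unit timelike normal, hence tangent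
(`mem_range_of_orthogonal_unit_normals`), and the Gauss formula `apply_christoffel_pullback`
identifies it with the image of the induced Christoffel term. Therefore the intrinsic Hessian of `f
∘ ι` is the restriction of the spacetime Hessian (`IsTimeSymmetric.hessian_pullback`), which on
nonzero spacelike vectors is at least `c g > 0`.

Along a geodesic the second derivative of `f ∘ γ` is the Hessian on the velocity, so `(f ∘ γ)'` is
monotone; being periodic it is constant, which forces the velocity to vanish. On a compact minimal
`S`, take a maximum of `f ∘ j`. The gradient of `f` is normal to `S` there, and the second
derivative of `f ∘ j` is the Hessian of `f` plus the second fundamental form in the gradient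
direction. The sum is nonpositive and the Hessian positive, so that form is negative definite and
its trace cannot vanish. -/

noncomputable section

namespace SpacetimeConvexity

/-! ### Linear algebra of definite and Lorentzian forms -/

section LinearAlgebra

variable {V : Type*} [NormedAddCommGroup V] [NormedSpace ℝ V] [FiniteDimensional ℝ V]
variable {W : Type*} [NormedAddCommGroup W] [NormedSpace ℝ W] [FiniteDimensional ℝ W]

/-- `ContinuousLinearMap.inverse` takes the value zero on non-invertible maps, so `christoffel` and
`metricTrace` have their intended meaning only once invertibility is known. -/
theorem isInvertible_of_nondegenerate (b : V →L[ℝ] V →L[ℝ] ℝ)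
    (hb : ∀ u, (∀ v, b u v = 0) → u = 0) : b.IsInvertible := by
  have hinj : Function.Injective (b : V →ₗ[ℝ] V →L[ℝ] ℝ) := by
    rw [← LinearMap.ker_eq_bot, LinearMap.ker_eq_bot']
    exact fun u hu => hb u fun v => by simpa using DFunLike.congr_fun hu v
  have hdim : Module.finrank ℝ V = Module.finrank ℝ (V →L[ℝ] ℝ) := by
    rw [← (LinearMap.toContinuousLinearMap (𝕜 := ℝ) (E := V) (F' := ℝ)).finrank_eq]
    exact Subspace.dual_finrank_eq.symm
  exact ⟨(LinearEquiv.ofInjectiveOfFinrankEq _ hinj hdim).toContinuousLinearEquiv, by ext; rfl⟩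

theorem isInvertible_of_posDef (b : V →L[ℝ] V →L[ℝ] ℝ) (hb : ∀ u, u ≠ 0 → 0 < b u u) :
    b.IsInvertible :=
  isInvertible_of_nondegenerate b fun u hu => by
    by_contra h
    exact (hb u h).ne' (hu u)

/-- The two indices already add up to the full dimension, which leaves no room for a radical.
Symmetry is needed because the quadratic form sees only the symmetric part of `b`. -/
theorem HasLorentzianSignature.nondegenerate {b : V →L[ℝ] V →L[ℝ] ℝ}
    (hb : HasLorentzianSignature b) (hs : ∀ u v, b u v = b v u) (u : V)
    (hu : ∀ v, b u v = 0) : u = 0 := by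
  obtain ⟨h1, h2⟩ := hb
  set Q : QuadraticForm ℝ V := LinearMap.BilinMap.toQuadraticMap
      (LinearMap.mk₂ ℝ (fun u v => b u v) (by simp) (by simp) (by simp) (by simp)) with hQ
  have h3 := QuadraticForm.sigPos_add_sigNeg_add_radical (Q := Q)
  have h4 : Module.finrank ℝ Q.radical = 0 := by lia
  have h5 : u ∈ Q.radical := by
    rw [QuadraticMap.mem_radical_iff']
    simp [hQ, hu, hs _ u]
  rw [Submodule.finrank_eq_zero.mp h4] at h5
  simpa using h5

theorem HasLorentzianSignature.exists_neg {b : V →L[ℝ] V →L[ℝ] ℝ}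
    (hb : HasLorentzianSignature b) : ∃ v, b v v < 0 := by
  obtain ⟨h1, -⟩ := hb
  obtain ⟨U, hU, hpos⟩ := exists_finrank_eq_sigNeg_and_negDef (LinearMap.BilinMap.toQuadraticMap
      (LinearMap.mk₂ ℝ (fun u v => b u v) (by simp) (by simp) (by simp) (by simp)))
  rw [h1] at hU
  obtain ⟨⟨v, hv⟩, hv0, -⟩ := finrank_eq_one_iff'.mp hU
  refine ⟨v, ?_⟩
  have := hpos ⟨v, hv⟩ hv0
  simpa using this

/-- A vector which is orthogonal to all unit timelike normals of a spacelike hyperplane lies in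
the hyperplane. -/
theorem mem_range_of_orthogonal_unit_normals {b : V →L[ℝ] V →L[ℝ] ℝ}
    (hb : HasLorentzianSignature b) (hs : ∀ u v, b u v = b v u) (A : W →L[ℝ] V)
    (hdim : Module.finrank ℝ V = Module.finrank ℝ W + 1)
    (hA : ∀ w, w ≠ 0 → 0 < b (A w) (A w)) (z : V)
    (hz : ∀ t, (∀ w, b t (A w) = 0) → b t t = -1 → b t z = 0) : ∃ w, z = A w := by
  let k : W →L[ℝ] W →L[ℝ] ℝ := ((ContinuousLinearMap.precomp ℝ A).comp b).comp A
  have hk : k.IsInvertible := isInvertible_of_posDef k hA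
  -- Orthogonal projection onto the range of `A`: `w` represents the functional `b v ∘ A` in the
  -- positive definite form `k`.
  have hdec : ∀ v, ∃ w, ∀ u, b (v - A w) (A u) = 0 := fun v => by
    refine ⟨k.inverse ((b v).comp A), fun u => ?_⟩
    have h : b (A (k.inverse ((b v).comp A))) (A u) = b v (A u) :=
      DFunLike.congr_fun (hk.self_apply_inverse ((b v).comp A)) u
    rw [map_sub, sub_apply, h, sub_self]
  obtain ⟨v, hv⟩ := hb.exists_neg
  obtain ⟨a, ha⟩ := hdec v
  set s := v - A a with hsdef
  have hs_neg : b s s < 0 := by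
    have hva : v = s + A a := by simp [hsdef]
    have h0 : 0 ≤ b (A a) (A a) := by
      by_cases h : a = 0
      · simp [h]
      · exact (hA a h).le
    rw [hva] at hv
    simp only [map_add, add_apply, ha, hs (A a) s] at hv
    linarith
  -- Rescaling makes `r • s` a unit timelike normal, to which `hz` applies.
  set r := (√(-b s s))⁻¹
  have hr : r * r * (-b s s) = 1 := by
    have h1 : √(-b s s) * √(-b s s) = -b s s := Real.mul_self_sqrt (by linarith)
    have h2 : √(-b s s) ≠ 0 := (Real.sqrt_pos.mpr (by linarith)).ne'
    calc r * r * (-b s s) = r * r * (√(-b s s) * √(-b s s)) := by rw [h1]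
      _ = (√(-b s s) * r) * (√(-b s s) * r) := by ring
      _ = 1 := by rw [mul_inv_cancel₀ h2, one_mul]
  have hsz : b s z = 0 := by
    have h := hz (r • s) (fun w => by simp [ha]) (by simp; linarith)
    have hr0 : r ≠ 0 := fun h => by simp [h] at hr
    simpa [hr0] using h
  -- By the dimension count `V` is the direct sum of the range of `A` and the line through `s`;
  -- pairing with `s` then kills the `s`-coefficient of `z`.
  let L : W × ℝ →ₗ[ℝ] V := (A : W →ₗ[ℝ] V).coprod (LinearMap.toSpanSingleton ℝ V s)
  have hL : ∀ w c, L (w, c) = A w + c • s := fun w c => by simp [L]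
  have hinj : Function.Injective L := by
    rw [← LinearMap.ker_eq_bot, LinearMap.ker_eq_bot']
    rintro ⟨w, c⟩ h
    rw [hL] at h
    have h1 : b s (A w + c • s) = 0 := by simp [h]
    simp only [map_add, ha, map_smul, smul_eq_mul, zero_add] at h1
    have hc : c = 0 := (mul_eq_zero.mp h1).resolve_right hs_neg.ne
    subst hc
    by_contra hw
    have hw' : w ≠ 0 := fun h' => hw (by simp [h'])
    have := hA w hw'
    rw [show A w = 0 by simpa using h] at this
    simp at this
  have hsurj := (LinearMap.injective_iff_surjective_of_finrank_eq_finrank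
    (f := L) (by simp [hdim])).mp hinj
  obtain ⟨⟨w, c⟩, rfl⟩ := hsurj z
  rw [hL] at hsz ⊢
  simp only [map_add, ha, map_smul, smul_eq_mul, zero_add] at hsz
  exact ⟨w, by simp [(mul_eq_zero.mp hsz).resolve_right hs_neg.ne]⟩

/-- In a `k`-orthogonal basis the diagonal entries of `k⁻¹ ∘ B` are `B(eᵢ, eᵢ) / k(eᵢ, eᵢ) < 0`. In
dimension zero the trace would be an empty sum. -/
theorem metricTrace_neg_of_negDef [Nontrivial V] {k B : V →L[ℝ] V →L[ℝ] ℝ}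
    (hs : ∀ u v, k u v = k v u) (hk : ∀ u, u ≠ 0 → 0 < k u u) (hB : ∀ u, u ≠ 0 → B u u < 0) :
    metricTrace k B < 0 := by
  have hinv := isInvertible_of_posDef k hk
  let K : LinearMap.BilinForm ℝ V :=
    LinearMap.mk₂ ℝ (fun u v => k u v) (by simp) (by simp) (by simp) (by simp)
  obtain ⟨e, he⟩ := LinearMap.BilinForm.exists_orthogonal_basis (B := K) ⟨hs⟩
  have horth : ∀ i j, i ≠ j → k (e i) (e j) = 0 := fun i j hij => he hij
  rw [metricTrace, LinearMap.trace_eq_matrix_trace ℝ e, Matrix.trace]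
  have : Nonempty (Fin (Module.finrank ℝ V)) := ⟨⟨0, Module.finrank_pos⟩⟩
  refine Finset.sum_neg (fun i _ => ?_) Finset.univ_nonempty
  rw [Matrix.diag_apply, LinearMap.toMatrix_apply]
  set T : V →L[ℝ] V := k.inverse.comp B
  have h1 : k (T (e i)) (e i) = B (e i) (e i) := by
    simp [T, hinv.self_apply_inverse]
  have h2 : k (T (e i)) (e i) = e.repr (T (e i)) i * k (e i) (e i) := by
    conv_lhs => rw [← e.sum_repr (T (e i))]
    simp only [map_sum, map_smul, sum_apply, smul_apply,
      smul_eq_mul]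
    exact Finset.sum_eq_single i (fun j _ hj => by simp [horth j i hj]) (by simp)
  have h3 := hB _ (e.ne_zero i)
  rw [← h1, h2] at h3
  exact neg_of_mul_neg_left h3 (hk _ (e.ne_zero i)).le

end LinearAlgebra

/-! ### Second-order calculus in normed spaces -/

section Calculus

variable {E : Type*} [NormedAddCommGroup E] [NormedSpace ℝ E]
variable {F : Type*} [NormedAddCommGroup F] [NormedSpace ℝ F]

theorem fderiv_fderiv_comm {Φ : E → F} {y : E} (hΦ : ContDiffAt ℝ 2 Φ y) (u v : E) :
    fderiv ℝ (fderiv ℝ Φ) y u v = fderiv ℝ (fderiv ℝ Φ) y v u :=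
  hΦ.isSymmSndFDerivAt (by simp) u v

theorem differentiableAt_fderiv_of_contDiffAt {Φ : E → F} {y : E} (hΦ : ContDiffAt ℝ 2 Φ y) :
    DifferentiableAt ℝ (fderiv ℝ Φ) y :=
  (hΦ.fderiv_right (m := 1) (by norm_num)).differentiableAt one_ne_zero

/-- The behaviour of the Christoffel symbols of the first kind under pullback. -/
theorem koszul_fderiv_pullback {G : F → F →L[ℝ] F →L[ℝ] ℝ} {Φ : E → F}
    {H : E → E →L[ℝ] E →L[ℝ] ℝ} {y : E} (hΦ : ContDiffAt ℝ 2 Φ y)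
    (hG : DifferentiableAt ℝ G (Φ y)) (hH : DifferentiableAt ℝ H y)
    (hs : ∀ u v, G (Φ y) u v = G (Φ y) v u)
    (hHG : ∀ᶠ x in 𝓝 y, ∀ u v, H x u v = G (Φ x) (fderiv ℝ Φ x u) (fderiv ℝ Φ x v))
    (u v w : E) :
    koszul (fderiv ℝ H y) u v w =
      koszul (fderiv ℝ G (Φ y)) (fderiv ℝ Φ y u) (fderiv ℝ Φ y v) (fderiv ℝ Φ y w)
        + G (Φ y) (fderiv ℝ (fderiv ℝ Φ) y u v) (fderiv ℝ Φ y w) := by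
  have hd := hΦ.differentiableAt two_ne_zero
  -- Product rule for `G (Φ x) (DΦ b) (DΦ c)`, one term for each of the three factors.
  have key : ∀ a b c, fderiv ℝ H y a b c =
      fderiv ℝ G (Φ y) (fderiv ℝ Φ y a) (fderiv ℝ Φ y b) (fderiv ℝ Φ y c)
        + G (Φ y) (fderiv ℝ (fderiv ℝ Φ) y a b) (fderiv ℝ Φ y c)
        + G (Φ y) (fderiv ℝ Φ y b) (fderiv ℝ (fderiv ℝ Φ) y a c) := fun a b c => by
    have hΦ' := fun d : E =>
      (differentiableAt_fderiv_of_contDiffAt hΦ).hasFDerivAt.clm_apply (hasFDerivAt_const d y)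
    have hG' := hG.hasFDerivAt.comp y hd.hasFDerivAt
    have h1 := ((hG'.clm_apply (hΦ' b)).clm_apply (hΦ' c))
    have h2 := (hH.hasFDerivAt.clm_apply (hasFDerivAt_const b y)).clm_apply (hasFDerivAt_const c y)
    have h3 := h2.unique (h1.congr_of_eventuallyEq (hHG.mono fun x hx => hx b c))
    have h4 := DFunLike.congr_fun h3 a
    simp at h4
    rw [h4]
    ring
  simp only [koszul_apply, key]
  -- Of the six terms containing `D²Φ`, symmetry of `G` and of `D²Φ` cancels four; the other two are
  -- equal and absorb the factor `1/2`.
  rw [hs (fderiv ℝ Φ y v) (fderiv ℝ (fderiv ℝ Φ) y u w),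
    hs (fderiv ℝ Φ y u) (fderiv ℝ (fderiv ℝ Φ) y v w),
    hs (fderiv ℝ Φ y u) (fderiv ℝ (fderiv ℝ Φ) y w v),
    fderiv_fderiv_comm hΦ v u, fderiv_fderiv_comm hΦ w u, fderiv_fderiv_comm hΦ w v]
  ring

/-- The second derivative of a composition. -/
theorem fderiv_fderiv_comp {G : Type*} [NormedAddCommGroup G] [NormedSpace ℝ G]
    {Ψ : F → G} {Φ : E → F} {y : E} (hΨ : ContDiffAt ℝ 2 Ψ (Φ y)) (hΦ : ContDiffAt ℝ 2 Φ y)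
    (u v : E) :
    fderiv ℝ (fderiv ℝ (Ψ ∘ Φ)) y u v =
      fderiv ℝ (fderiv ℝ Ψ) (Φ y) (fderiv ℝ Φ y u) (fderiv ℝ Φ y v)
        + fderiv ℝ Ψ (Φ y) (fderiv ℝ (fderiv ℝ Φ) y u v) := by
  have hd := hΦ.differentiableAt two_ne_zero
  have heq : fderiv ℝ (Ψ ∘ Φ) =ᶠ[𝓝 y] fun x => (fderiv ℝ Ψ (Φ x)).comp (fderiv ℝ Φ x) := by
    have h1 := hΦ.eventually (by simp)
    have h2 := hΦ.continuousAt.eventually (hΨ.eventually (by simp))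
    filter_upwards [h1, h2] with x hx1 hx2
    exact fderiv_comp x (hx2.differentiableAt two_ne_zero) (hx1.differentiableAt two_ne_zero)
  have h1 : HasFDerivAt (fun x => fderiv ℝ Ψ (Φ x)) _ y :=
    (differentiableAt_fderiv_of_contDiffAt hΨ).hasFDerivAt.comp y hd.hasFDerivAt
  have h2 := h1.clm_comp (differentiableAt_fderiv_of_contDiffAt hΦ).hasFDerivAt
  rw [heq.fderiv_eq, h2.fderiv]
  simp [add_comm]

/-- The second derivative of a real function is negative semidefinite at a local maximum. -/
theorem fderiv_fderiv_nonpos_of_isLocalMax {Φ : E → ℝ} {y : E} (hΦ : ContDiffAt ℝ 2 Φ y)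
    (hmax : IsLocalMax Φ y) (u : E) : fderiv ℝ (fderiv ℝ Φ) y u u ≤ 0 := by
  by_contra! hpos
  have hl : ∀ r : ℝ, HasDerivAt (fun r : ℝ => y + r • u) u r := fun r => by
    simpa using ((hasDerivAt_id r).smul_const u).const_add y
  have hl0 : Filter.Tendsto (fun r : ℝ => y + r • u) (𝓝 0) (𝓝 y) := by
    have := (hl 0).continuousAt.tendsto
    simpa using this
  set φ : ℝ → ℝ := fun r => Φ (y + r • u) with hφ
  have hd : deriv φ =ᶠ[𝓝 0] fun r => fderiv ℝ Φ (y + r • u) u := by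
    filter_upwards [hl0.eventually (hΦ.eventually (by simp))] with r hr
    exact ((hr.differentiableAt two_ne_zero).hasFDerivAt.comp_hasDerivAt r (hl r)).deriv
  have hdd : deriv (deriv φ) 0 = fderiv ℝ (fderiv ℝ Φ) y u u := by
    rw [hd.deriv_eq]
    have h1 : HasFDerivAt (fderiv ℝ Φ) (fderiv ℝ (fderiv ℝ Φ) y) (y + (0 : ℝ) • u) := by
      simpa using (differentiableAt_fderiv_of_contDiffAt hΦ).hasFDerivAt
    have h2 : HasDerivAt (fun r : ℝ => fderiv ℝ Φ (y + r • u)) (fderiv ℝ (fderiv ℝ Φ) y u) 0 :=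
      h1.comp_hasDerivAt (0 : ℝ) (hl 0)
    exact ((ContinuousLinearMap.apply ℝ ℝ u).hasFDerivAt.comp_hasDerivAt (0 : ℝ) h2).deriv
  have hcont : ContinuousAt φ 0 := by
    have h : ContinuousAt Φ (y + (0 : ℝ) • u) := by simpa using hΦ.continuousAt
    exact ContinuousAt.comp (f := fun r : ℝ => y + r • u) h (hl 0).continuousAt
  have hmaxφ : IsLocalMax φ 0 := by
    filter_upwards [hl0.eventually hmax] with r hr
    simpa [hφ] using hr
  -- A positive second derivative would make the local maximum a local minimum too, so `φ` would be
  -- locally constant and its second derivative zero.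
  have hmin := isLocalMin_of_deriv_deriv_pos (hdd ▸ hpos) hmaxφ.deriv_eq_zero hcont
  have hconst : φ =ᶠ[𝓝 0] fun _ => φ 0 := by
    filter_upwards [hmaxφ, hmin] with r h1 h2
    exact le_antisymm h1 h2
  have : deriv (deriv φ) 0 = 0 := by
    rw [hconst.deriv.deriv_eq]
    simp
  linarith

end Calculus

/-! ### Metrics and maps in preferred charts -/

section Charts

theorem two_le_infty : (2 : WithTop ℕ∞) ≤ ∞ := by
  change ((2 : ℕ∞) : WithTop ℕ∞) ≤ ∞
  exact WithTop.coe_le_coe.mpr le_top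

variable {m : ℕ} {M : Type*} [TopologicalSpace M] [ChartedSpace (EuclideanSpace ℝ (Fin m)) M]
variable {k : ℕ} {N : Type*} [TopologicalSpace N] [ChartedSpace (EuclideanSpace ℝ (Fin k)) N]

theorem contDiffAt_writtenInExtChartAt {F : N → M} (hF : ContMDiff (𝓡 k) (𝓡 m) ∞ F) (x : N) :
    ContDiffAt ℝ ∞ (writtenInExtChartAt (𝓡 k) (𝓡 m) x F) (extChartAt (𝓡 k) x x) := by
  have h := (contMDiffAt_iff.mp (hF x)).2
  simpa [contDiffWithinAt_univ] using! h

theorem mfderiv_eq_fderiv_writtenInExtChartAt {F : N → M} (hF : ContMDiff (𝓡 k) (𝓡 m) ∞ F)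
    (x : N) : mfderiv (𝓡 k) (𝓡 m) F x =
      fderiv ℝ (writtenInExtChartAt (𝓡 k) (𝓡 m) x F) (extChartAt (𝓡 k) x x) := by
  rw [((hF x).mdifferentiableAt (by simp)).mfderiv]
  simp only [modelWithCornersSelf_coe, range_id, fderivWithin_univ]
  rfl

theorem writtenInExtChartAt_self (F : N → M) (x : N) :
    writtenInExtChartAt (𝓡 k) (𝓡 m) x F (extChartAt (𝓡 k) x x) = extChartAt (𝓡 m) (F x) (F x) := by
  simp [writtenInExtChartAt]

theorem eventually_map_extChartAt_symm_mem {F : N → M} (hF : Continuous F) (x : N) :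
    ∀ᶠ y in 𝓝 (extChartAt (𝓡 k) x x), y ∈ (extChartAt (𝓡 k) x).target ∧
      F ((extChartAt (𝓡 k) x).symm y) ∈ (extChartAt (𝓡 m) (F x)).source := by
  refine Filter.Eventually.and (extChartAt_target_mem_nhds x) ?_
  have h : ContinuousAt (F ∘ (extChartAt (𝓡 k) x).symm) (extChartAt (𝓡 k) x x) :=
    hF.continuousAt.comp (continuousAt_extChartAt_symm x)
  exact h.eventually_mem (by simpa using extChartAt_source_mem_nhds (I := 𝓡 m) (F x))

variable [IsManifold (𝓡 m) ∞ M] [IsManifold (𝓡 k) ∞ N]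

theorem contMDiffAt_extChartAt_symm (p : M) {y : EuclideanSpace ℝ (Fin m)}
    (hy : y ∈ (extChartAt (𝓡 m) p).target) :
    ContMDiffAt (𝓡 m) (𝓡 m) ∞ (extChartAt (𝓡 m) p).symm y :=
  (contMDiffOn_extChartAt_symm p).contMDiffAt (extChartAt_target_mem_nhds' hy)

theorem contDiffAt_comp_extChartAt_symm {f : M → ℝ} (hf : ContMDiff (𝓡 m) 𝓘(ℝ, ℝ) ∞ f) (p : M) :
    ContDiffAt ℝ ∞ (f ∘ (extChartAt (𝓡 m) p).symm) (extChartAt (𝓡 m) p p) :=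
  (hf.contMDiffAt.comp _
    (contMDiffAt_extChartAt_symm p (mem_extChartAt_target p))).contDiffAt

/-- The tangent space at `p` is identified with the model space through the preferred chart at `p`
itself, so the inverse chart has identity derivative at the centre. -/
theorem metricInChart_self (g : BilinField m M) (p : M) :
    metricInChart g p (extChartAt (𝓡 m) p p) = g p := by
  have hq : (extChartAt (𝓡 m) p).symm (extChartAt (𝓡 m) p p) = p := extChartAt_to_inv p
  have hA : mfderiv (𝓡 m) (𝓡 m) (extChartAt (𝓡 m) p).symm (extChartAt (𝓡 m) p p) =
      ContinuousLinearMap.id ℝ (EuclideanSpace ℝ (Fin m)) := by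
    rw [← mfderivWithin_univ]
    simpa using! mfderivWithin_range_extChartAt_symm (I := 𝓡 m) (x := p)
  -- The type of `g q` depends on `q`, so the equality of base points is transported after viewing
  -- the arguments in the model space.
  have hg : ∀ q, q = p → ∀ a b : EuclideanSpace ℝ (Fin m),
      (g q : EuclideanSpace ℝ (Fin m) →L[ℝ] EuclideanSpace ℝ (Fin m) →L[ℝ] ℝ) a b = g p a b :=
    fun q h a b => by rw [h]
  ext u v
  change g _ (mfderiv (𝓡 m) (𝓡 m) (extChartAt (𝓡 m) p).symm (extChartAt (𝓡 m) p p) u)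
    (mfderiv (𝓡 m) (𝓡 m) (extChartAt (𝓡 m) p).symm (extChartAt (𝓡 m) p p) v) = _
  rw [hA]
  exact hg _ hq u v

/-- The identity is needed on a neighbourhood, not just at the centre, because the Christoffel
symbols differentiate it. -/
theorem metricInChart_pullback (g : BilinField m M) {F : N → M}
    (hF : ContMDiff (𝓡 k) (𝓡 m) ∞ F) (x : N) :
    ∀ᶠ y in 𝓝 (extChartAt (𝓡 k) x x), ∀ u v,
      metricInChart (pullback (k := k) g F) x y u v =
        metricInChart g (F x) (writtenInExtChartAt (𝓡 k) (𝓡 m) x F y)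
          (fderiv ℝ (writtenInExtChartAt (𝓡 k) (𝓡 m) x F) y u)
          (fderiv ℝ (writtenInExtChartAt (𝓡 k) (𝓡 m) x F) y v) := by
  have hev := eventually_map_extChartAt_symm_mem (m := m) (k := k) hF.continuous x
  filter_upwards [hev.eventually_nhds,
    (contDiffAt_writtenInExtChartAt hF x).of_le (m := 1) (by simp) |>.eventually (by simp)]
    with y hy hdiff u v
  obtain ⟨hy1, hy2⟩ := hy.self_of_nhds
  set Φ := writtenInExtChartAt (𝓡 k) (𝓡 m) x F with hΦ
  have hq : (extChartAt (𝓡 m) (F x)).symm (Φ y) = F ((extChartAt (𝓡 k) x).symm y) :=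
    (extChartAt (𝓡 m) (F x)).left_inv hy2
  -- The same map is factored in two ways; the chain rule for both gives `hchain`.
  have hlocal : F ∘ (extChartAt (𝓡 k) x).symm =ᶠ[𝓝 y] (extChartAt (𝓡 m) (F x)).symm ∘ Φ := by
    filter_upwards [hy] with z hz
    exact ((extChartAt (𝓡 m) (F x)).left_inv hz.2).symm
  have hΦy : Φ y ∈ (extChartAt (𝓡 m) (F x)).target := (extChartAt (𝓡 m) (F x)).map_source hy2
  have hchain : ∀ w : EuclideanSpace ℝ (Fin k),
      mfderiv (𝓡 k) (𝓡 m) F ((extChartAt (𝓡 k) x).symm y)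
        (mfderiv (𝓡 k) (𝓡 k) (extChartAt (𝓡 k) x).symm y w) =
      (mfderiv (𝓡 m) (𝓡 m) (extChartAt (𝓡 m) (F x)).symm (Φ y) (fderiv ℝ Φ y w) :
        EuclideanSpace ℝ (Fin m)) := fun w => by
    have h1 := mfderiv_comp_apply (I := 𝓡 k) (I' := 𝓡 k) (I'' := 𝓡 m) y
      (hF.contMDiffAt.mdifferentiableAt (by simp))
      ((contMDiffAt_extChartAt_symm x hy1).mdifferentiableAt (by simp)) w
    have h2 := mfderiv_comp_apply (I := 𝓡 k) (I' := 𝓡 m) (I'' := 𝓡 m) y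
      ((contMDiffAt_extChartAt_symm (F x) hΦy).mdifferentiableAt (by simp))
      (hdiff.differentiableAt one_ne_zero).mdifferentiableAt w
    rw [mfderiv_eq_fderiv] at h2
    rw [hlocal.mfderiv_eq] at h1
    exact h1.symm.trans h2
  have hg : ∀ q q', q = q' →
      (g q : EuclideanSpace ℝ (Fin m) →L[ℝ] EuclideanSpace ℝ (Fin m) →L[ℝ] ℝ) = g q' :=
    fun q q' h => by rw [h]
  change (g (F ((extChartAt (𝓡 k) x).symm y)) :
      EuclideanSpace ℝ (Fin m) →L[ℝ] EuclideanSpace ℝ (Fin m) →L[ℝ] ℝ)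
      (mfderiv (𝓡 k) (𝓡 m) F ((extChartAt (𝓡 k) x).symm y)
        (mfderiv (𝓡 k) (𝓡 k) (extChartAt (𝓡 k) x).symm y u))
      (mfderiv (𝓡 k) (𝓡 m) F ((extChartAt (𝓡 k) x).symm y)
        (mfderiv (𝓡 k) (𝓡 k) (extChartAt (𝓡 k) x).symm y v)) =
    (g ((extChartAt (𝓡 m) (F x)).symm (Φ y)) :
      EuclideanSpace ℝ (Fin m) →L[ℝ] EuclideanSpace ℝ (Fin m) →L[ℝ] ℝ)
      (mfderiv (𝓡 m) (𝓡 m) (extChartAt (𝓡 m) (F x)).symm (Φ y) (fderiv ℝ Φ y u))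
      (mfderiv (𝓡 m) (𝓡 m) (extChartAt (𝓡 m) (F x)).symm (Φ y) (fderiv ℝ Φ y v))
  rw [hg _ _ hq]
  erw [hchain u, hchain v]
  rfl

/-- Smoothness of `g` is given in the trivialization of the hom bundle. The inverse of the tangent
trivialization is the derivative of the inverse chart, so the trivialized `g` coincides with
`metricInChart` near the centre. -/
theorem IsLorentzianMetric.differentiableAt_metricInChart {g : BilinField m M}
    (hg : IsLorentzianMetric g) (p : M) :
    DifferentiableAt ℝ (metricInChart g p) (extChartAt (𝓡 m) p p) := by
  have h := ((contMDiffAt_hom_bundle _).mp (hg.contMDiff p)).2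
  have hp : (extChartAt (𝓡 m) p).symm (extChartAt (𝓡 m) p p) = p := extChartAt_to_inv p
  have h2 := ContMDiffAt.comp_of_eq h
    (contMDiffAt_extChartAt_symm p (mem_extChartAt_target p)) hp
  refine (h2.contDiffAt.differentiableAt (by simp)).congr_of_eventuallyEq ?_
  filter_upwards [extChartAt_target_mem_nhds (I := 𝓡 m) p] with y hy
  have hy' : (extChartAt (𝓡 m) p).symm y ∈ (chartAt (EuclideanSpace ℝ (Fin m)) p).source := by
    simpa using (extChartAt (𝓡 m) p).map_target hy
  have hA := TangentBundle.symmL_trivializationAt (I := 𝓡 m) hy'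
  rw [(extChartAt (𝓡 m) p).right_inv hy] at hA
  simp only [modelWithCornersSelf_coe, range_id, mfderivWithin_univ] at hA
  ext u v
  simp only [Function.comp_apply]
  rw [inCoordinates_apply_eq₂ hy' hy' (mem_univ _)]
  simp only [Bundle.Trivial.fiberBundle_trivializationAt',
    Bundle.Trivial.linearMapAt_trivialization, LinearMap.id_coe, id_eq]
  have hA' : ∀ w : EuclideanSpace ℝ (Fin m),
      (trivializationAt (EuclideanSpace ℝ (Fin m)) (TangentSpace (𝓡 m)) p).symm
        ((extChartAt (𝓡 m) p).symm y) w =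
      mfderiv (𝓡 m) (𝓡 m) (extChartAt (𝓡 m) p).symm y w := fun w =>
    (Bundle.Trivialization.symmL_apply _ hy' _).symm.trans (DFunLike.congr_fun hA w)
  rw [hA', hA']
  rfl

theorem differentiableAt_metricInChart_pullback {g : BilinField m M} {F : N → M}
    (hF : ContMDiff (𝓡 k) (𝓡 m) ∞ F) (x : N)
    (hg : DifferentiableAt ℝ (metricInChart g (F x)) (extChartAt (𝓡 m) (F x) (F x))) :
    DifferentiableAt ℝ (metricInChart (pullback (k := k) g F) x) (extChartAt (𝓡 k) x x) := by
  set Φ := writtenInExtChartAt (𝓡 k) (𝓡 m) x F with hΦ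
  have hΦ2 : ContDiffAt ℝ 2 Φ (extChartAt (𝓡 k) x x) :=
    (contDiffAt_writtenInExtChartAt hF x).of_le two_le_infty
  have hΦ1 := differentiableAt_fderiv_of_contDiffAt hΦ2
  rw [← writtenInExtChartAt_self (k := k) (m := m) F x] at hg
  have hG := hg.comp _ (hΦ2.differentiableAt two_ne_zero)
  have hpre := ((ContinuousLinearMap.compL ℝ (EuclideanSpace ℝ (Fin k))
    (EuclideanSpace ℝ (Fin m)) ℝ).flip.differentiableAt).comp _ hΦ1
  refine ((hpre.clm_comp hG).clm_comp hΦ1).congr_of_eventuallyEq ?_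
  filter_upwards [metricInChart_pullback g hF x] with y hy
  ext u v
  exact hy u v

end Charts

/-! ### Hessians of compositions and the Gauss formula -/

section Gauss

variable {m : ℕ} {M : Type*} [TopologicalSpace M] [ChartedSpace (EuclideanSpace ℝ (Fin m)) M]
variable {k : ℕ} {N : Type*} [TopologicalSpace N] [ChartedSpace (EuclideanSpace ℝ (Fin k)) N]

theorem covDerivDifferential_apply (g : BilinField m M) (F : N → M) (x : N)
    (u v : EuclideanSpace ℝ (Fin k)) :
    covDerivDifferential (k := k) g F x u v =
      fderiv ℝ (fderiv ℝ (writtenInExtChartAt (𝓡 k) (𝓡 m) x F)) (extChartAt (𝓡 k) x x) u v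
        + christoffel g (F x)
            (fderiv ℝ (writtenInExtChartAt (𝓡 k) (𝓡 m) x F) (extChartAt (𝓡 k) x x) u)
            (fderiv ℝ (writtenInExtChartAt (𝓡 k) (𝓡 m) x F) (extChartAt (𝓡 k) x x) v) :=
  rfl

theorem hessian_apply (g : BilinField m M) (f : M → ℝ) (p : M) (u v : EuclideanSpace ℝ (Fin m)) :
    hessian g f p u v =
      fderiv ℝ (fderiv ℝ (f ∘ (extChartAt (𝓡 m) p).symm)) (extChartAt (𝓡 m) p p) u v
        - fderiv ℝ (f ∘ (extChartAt (𝓡 m) p).symm) (extChartAt (𝓡 m) p p)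
            (christoffel g p u v) :=
  rfl

theorem comp_extChartAt_symm_eventuallyEq {F : N → M} (hF : Continuous F) (f : M → ℝ) (x : N) :
    (f ∘ F) ∘ (extChartAt (𝓡 k) x).symm =ᶠ[𝓝 (extChartAt (𝓡 k) x x)]
      (f ∘ (extChartAt (𝓡 m) (F x)).symm) ∘ writtenInExtChartAt (𝓡 k) (𝓡 m) x F := by
  filter_upwards [eventually_map_extChartAt_symm_mem (m := m) hF x] with y hy
  simp only [writtenInExtChartAt, Function.comp_apply]
  rw [(extChartAt (𝓡 m) (F x)).left_inv hy.2]

variable [IsManifold (𝓡 m) ∞ M]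

theorem fderiv_comp_extChartAt_symm {F : N → M} (hF : ContMDiff (𝓡 k) (𝓡 m) ∞ F) {f : M → ℝ}
    (hf : ContMDiff (𝓡 m) 𝓘(ℝ, ℝ) ∞ f) (x : N) (u : EuclideanSpace ℝ (Fin k)) :
    fderiv ℝ ((f ∘ F) ∘ (extChartAt (𝓡 k) x).symm) (extChartAt (𝓡 k) x x) u =
      fderiv ℝ (f ∘ (extChartAt (𝓡 m) (F x)).symm) (extChartAt (𝓡 m) (F x) (F x))
        (mfderiv (𝓡 k) (𝓡 m) F x u) := by
  have hpt := writtenInExtChartAt_self (k := k) (m := m) F x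
  have hΨ := contDiffAt_comp_extChartAt_symm (m := m) hf (F x)
  rw [← hpt] at hΨ
  rw [(comp_extChartAt_symm_eventuallyEq (m := m) (k := k) hF.continuous f x).fderiv_eq,
    fderiv_comp _ (hΨ.differentiableAt (by simp))
      ((contDiffAt_writtenInExtChartAt (m := m) (k := k) hF x).differentiableAt (by simp)), hpt,
    mfderiv_eq_fderiv_writtenInExtChartAt hF]
  rfl

/-- The second derivative of `f ∘ F` in coordinates, in terms of the Hessian of `f` and of the
covariant derivative of `dF`. -/
theorem fderiv_fderiv_comp_extChartAt_symm (g : BilinField m M) {F : N → M}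
    (hF : ContMDiff (𝓡 k) (𝓡 m) ∞ F) {f : M → ℝ}
    (hf : ContMDiff (𝓡 m) 𝓘(ℝ, ℝ) ∞ f) (x : N) (u v : EuclideanSpace ℝ (Fin k)) :
    fderiv ℝ (fderiv ℝ ((f ∘ F) ∘ (extChartAt (𝓡 k) x).symm)) (extChartAt (𝓡 k) x x) u v =
      hessian g f (F x) (mfderiv (𝓡 k) (𝓡 m) F x u) (mfderiv (𝓡 k) (𝓡 m) F x v)
        + fderiv ℝ (f ∘ (extChartAt (𝓡 m) (F x)).symm) (extChartAt (𝓡 m) (F x) (F x))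
          (covDerivDifferential (k := k) g F x u v) := by
  have hpt := writtenInExtChartAt_self (k := k) (m := m) F x
  have hΨ := contDiffAt_comp_extChartAt_symm (m := m) hf (F x)
  rw [← hpt] at hΨ
  rw [(comp_extChartAt_symm_eventuallyEq (m := m) (k := k) hF.continuous f x).fderiv.fderiv_eq,
    fderiv_fderiv_comp (hΨ.of_le two_le_infty)
      ((contDiffAt_writtenInExtChartAt (m := m) (k := k) hF x).of_le two_le_infty), hpt,
    mfderiv_eq_fderiv_writtenInExtChartAt hF, covDerivDifferential_apply]
  -- Here `c` is `df(Γ(dF u, dF v))`: subtracted from `D²f` it gives the Hessian, added to `df(D²F)`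
  -- the covariant derivative.
  have key : ∀ a b c : ℝ, a + b = (a - c) + (b + c) := fun a b c => by ring
  rw [map_add]
  exact key _ _ _

variable [IsManifold (𝓡 k) ∞ N]

theorem apply_christoffel (g : BilinField m M) (p : M)
    (hg : ∀ u : TangentSpace (𝓡 m) p, (∀ v, g p u v = 0) → u = 0)
    (u v w : EuclideanSpace ℝ (Fin m)) :
    metricInChart g p (extChartAt (𝓡 m) p p) (christoffel g p u v) w =
      koszul (fderiv ℝ (metricInChart g p) (extChartAt (𝓡 m) p p)) u v w := by
  have hinv : (metricInChart g p (extChartAt (𝓡 m) p p)).IsInvertible := by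
    rw [metricInChart_self]
    exact isInvertible_of_nondegenerate (V := EuclideanSpace ℝ (Fin m)) (g p) hg
  exact DFunLike.congr_fun (hinv.self_apply_inverse (christoffelFirst g p u v)) w

/-- **Gauss formula**: the tangential part of `∇_u (dF v)` is given by the Levi-Civita
connection of the induced metric. -/
theorem apply_christoffel_pullback {g : BilinField m M} {F : N → M}
    (hF : ContMDiff (𝓡 k) (𝓡 m) ∞ F) (x : N)
    (hd : DifferentiableAt ℝ (metricInChart g (F x)) (extChartAt (𝓡 m) (F x) (F x)))
    (hs : ∀ u v : TangentSpace (𝓡 m) (F x), g (F x) u v = g (F x) v u)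
    (hg : ∀ u : TangentSpace (𝓡 m) (F x), (∀ v, g (F x) u v = 0) → u = 0)
    (hh : ∀ u : TangentSpace (𝓡 k) x, (∀ v, pullback (k := k) g F x u v = 0) → u = 0)
    (u v w : EuclideanSpace ℝ (Fin k)) :
    pullback (k := k) g F x (christoffel (pullback (k := k) g F) x u v) w =
      g (F x) (covDerivDifferential (k := k) g F x u v) (mfderiv (𝓡 k) (𝓡 m) F x w) := by
  have h1 := apply_christoffel (pullback (k := k) g F) x hh u v w
  have hΦ2 : ContDiffAt ℝ 2 (writtenInExtChartAt (𝓡 k) (𝓡 m) x F) (extChartAt (𝓡 k) x x) :=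
    (contDiffAt_writtenInExtChartAt hF x).of_le two_le_infty
  have hpt := writtenInExtChartAt_self (k := k) (m := m) F x
  have h2 := koszul_fderiv_pullback hΦ2 (by rwa [hpt])
    (differentiableAt_metricInChart_pullback hF x hd)
    (by rw [hpt, metricInChart_self]; exact hs) (metricInChart_pullback g hF x) u v w
  -- The Christoffel term of `g` and the second derivative of `F` combine into the covariant
  -- derivative of `dF`.
  rw [hpt, ← apply_christoffel g (F x) hg, ← add_apply, ← map_add, add_comm,
    ← covDerivDifferential_apply, metricInChart_self] at h2
  rw [h2, metricInChart_self] at h1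
  rw [mfderiv_eq_fderiv_writtenInExtChartAt hF]
  exact h1

end Gauss

/-! ### Obstructions coming from a strictly convex function -/

section ConvexFunctions

variable {k : ℕ} {N : Type*} [TopologicalSpace N] [ChartedSpace (EuclideanSpace ℝ (Fin k)) N]

theorem deriv_deriv_eq_fderiv_fderiv {E : Type*} [NormedAddCommGroup E] [NormedSpace ℝ E]
    {c : ℝ → E} {t : ℝ} (hc : ContDiffAt ℝ 2 c t) :
    deriv (deriv c) t = fderiv ℝ (fderiv ℝ c) t 1 1 := by
  have h : deriv c = fun s => ContinuousLinearMap.apply ℝ E (1 : ℝ) (fderiv ℝ c s) := by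
    ext s
    simp
  rw [h]
  exact ((ContinuousLinearMap.apply ℝ E (1 : ℝ)).hasFDerivAt.comp_hasDerivAt t
    (differentiableAt_fderiv_of_contDiffAt hc).hasFDerivAt.hasDerivAt).deriv

theorem contDiffAt_extChartAt_comp {γ : ℝ → N} (hγ : ContMDiff 𝓘(ℝ, ℝ) (𝓡 k) ∞ γ) (t : ℝ) :
    ContDiffAt ℝ ∞ (fun s => extChartAt (𝓡 k) (γ t) (γ s)) t :=
  ((contMDiffAt_extChartAt (I := 𝓡 k) (x := γ t)).comp t hγ.contMDiffAt).contDiffAt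

variable [IsManifold (𝓡 k) ∞ N]

/-- The second derivative of a function along a geodesic is given by its Hessian. -/
theorem IsClosedGeodesic.deriv_deriv_comp {h : BilinField k N} {γ : ℝ → N}
    (hγ : IsClosedGeodesic h γ) {f : N → ℝ} (hf : ContMDiff (𝓡 k) 𝓘(ℝ, ℝ) ∞ f) (t : ℝ) :
    deriv (deriv (f ∘ γ)) t =
      hessian h f (γ t) (deriv (fun s => extChartAt (𝓡 k) (γ t) (γ s)) t)
        (deriv (fun s => extChartAt (𝓡 k) (γ t) (γ s)) t) := by
  have hgeo := hγ.geodesic t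
  set c : ℝ → EuclideanSpace ℝ (Fin k) := fun s => extChartAt (𝓡 k) (γ t) (γ s) with hc
  have hc2 : ContDiffAt ℝ 2 c t :=
    (contDiffAt_extChartAt_comp hγ.contMDiff t).of_le two_le_infty
  have hf2 : ContDiffAt ℝ 2 (f ∘ (extChartAt (𝓡 k) (γ t)).symm) (c t) :=
    (contDiffAt_comp_extChartAt_symm hf (γ t)).of_le two_le_infty
  have heq : f ∘ γ =ᶠ[𝓝 t] (f ∘ (extChartAt (𝓡 k) (γ t)).symm) ∘ c := by
    filter_upwards [hγ.contMDiff.continuous.continuousAt.eventually_mem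
      (extChartAt_source_mem_nhds (I := 𝓡 k) (γ t))] with s hs
    simp only [hc, Function.comp_apply]
    rw [(extChartAt (𝓡 k) (γ t)).left_inv hs]
  -- The geodesic equation replaces `c''` by `-Γ(c', c')`, which is exactly the correction term in
  -- the Hessian.
  rw [heq.deriv.deriv_eq, deriv_deriv_eq_fderiv_fderiv (hf2.comp t hc2),
    fderiv_fderiv_comp hf2 hc2, ← deriv_deriv_eq_fderiv_fderiv hc2,
    eq_neg_of_add_eq_zero_left hgeo, map_neg, ← sub_eq_add_neg]
  rfl

/-- The chart in `h0` moves with `t`. Passing through `mfderiv` allows the vanishing to be read in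
one fixed chart near `t₀`; local constancy then spreads over the connected line. -/
theorem eq_of_forall_deriv_extChartAt_eq_zero {γ : ℝ → N} (hγ : ContMDiff 𝓘(ℝ, ℝ) (𝓡 k) ∞ γ)
    (h0 : ∀ t, deriv (fun s => extChartAt (𝓡 k) (γ t) (γ s)) t = 0) (s t : ℝ) : γ s = γ t := by
  have hm : ∀ t, mfderiv 𝓘(ℝ, ℝ) (𝓡 k) γ t = 0 := fun t => by
    rw [(hγ.contMDiffAt.mdifferentiableAt (by simp)).mfderiv]
    ext1
    simp only [modelWithCornersSelf_coe, range_id, fderivWithin_univ]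
    exact h0 t
  suffices IsLocallyConstant γ from this.apply_eq_of_isPreconnected isPreconnected_univ
    (mem_univ s) (mem_univ t)
  rw [IsLocallyConstant.iff_eventually_eq]
  intro t₀
  have hmem := hγ.continuous.continuousAt.eventually_mem
      (extChartAt_source_mem_nhds (I := 𝓡 k) (γ t₀))
  obtain ⟨ε, hε, hball⟩ := Metric.eventually_nhds_iff_ball.mp hmem
  have hd : ∀ s ∈ Metric.ball t₀ ε,
      HasFDerivAt (fun s => extChartAt (𝓡 k) (γ t₀) (γ s)) (0 : ℝ →L[ℝ] _) s := fun s hs => by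
    have h1 : MDifferentiableAt (𝓡 k) (𝓡 k) (extChartAt (𝓡 k) (γ t₀)) (γ s) :=
      mdifferentiableAt_extChartAt (by simpa using hball s hs)
    have h2 := (hγ.contMDiffAt (x := s)).mdifferentiableAt (by simp)
    have h3 := mfderiv_comp s h1 h2
    rw [hm, mfderiv_eq_fderiv] at h3
    have h4 := (h1.comp s h2).differentiableAt.hasFDerivAt
    rw [h3.trans (ContinuousLinearMap.comp_zero _)] at h4
    exact h4
  filter_upwards [Metric.ball_mem_nhds t₀ hε] with s hs
  refine (extChartAt (𝓡 k) (γ t₀)).injOn (hball s hs) (mem_extChartAt_source _) ?_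
  exact Metric.isOpen_ball.is_const_of_fderiv_eq_zero (convex_ball t₀ ε).isPreconnected
    (fun s hs => (hd s hs).differentiableAt.differentiableWithinAt)
    (fun s hs => (hd s hs).fderiv) hs (Metric.mem_ball_self hε)

/-- For `a ≤ b` some `a + n T` lies beyond `b`, so `φ b` is squeezed between `φ a` and `φ (a + n T)
= φ a`. -/
theorem eq_of_monotone_of_periodic {φ : ℝ → ℝ} (hφ : Monotone φ) {T : ℝ} (hT : 0 < T)
    (hper : Function.Periodic φ T) (a b : ℝ) : φ a = φ b := by
  wlog hab : a ≤ b generalizing a b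
  · exact (this b a (le_of_not_ge hab)).symm
  obtain ⟨n, hn⟩ := exists_nat_ge ((b - a) / T)
  have h1 : b ≤ a + n * T := by
    rw [div_le_iff₀ hT] at hn
    linarith
  exact le_antisymm (hφ hab) ((hφ h1).trans_eq (hper.nat_mul n a))

/-- A manifold with a strictly convex function has no closed geodesics. -/
theorem not_isClosedGeodesic_of_hessian_pos {h : BilinField k N} {f : N → ℝ}
    (hf : ContMDiff (𝓡 k) 𝓘(ℝ, ℝ) ∞ f)
    (hpos : ∀ (x : N) (u : TangentSpace (𝓡 k) x), u ≠ 0 → 0 < hessian h f x u u) (γ : ℝ → N) :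
    ¬ IsClosedGeodesic h γ := by
  intro hγ
  have hsmooth : ContDiff ℝ 2 (f ∘ γ) :=
    (contMDiff_iff_contDiff.mp (hf.comp hγ.contMDiff)).of_le two_le_infty
  have hdiff : Differentiable ℝ (deriv (f ∘ γ)) :=
    (hsmooth.iterate_deriv' 1 1).differentiable (by simp)
  have hnonneg : ∀ (x : N) (u : TangentSpace (𝓡 k) x), 0 ≤ hessian h f x u u := fun x u => by
    by_cases hu : u = 0
    · simp [hu]
    · exact (hpos x u hu).le
  have hmono : Monotone (deriv (f ∘ γ)) := monotone_of_deriv_nonneg hdiff fun t =>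
    (hnonneg (γ t) _).trans_eq (hγ.deriv_deriv_comp hf t).symm
  obtain ⟨T, hT, hper⟩ := hγ.periodic
  have hper' : Function.Periodic (deriv (f ∘ γ)) T := fun t => by
    rw [← deriv_comp_add_const]
    congr 1
    ext s
    simp [hper s]
  have hconst := eq_of_monotone_of_periodic hmono hT hper'
  obtain ⟨s, t, hst⟩ := hγ.nonconstant
  refine hst (eq_of_forall_deriv_extChartAt_eq_zero hγ.contMDiff (fun t => ?_) s t)
  by_contra hu
  have h1 := hpos (γ t) _ hu
  have h2 : deriv (f ∘ γ) = fun _ => deriv (f ∘ γ) 0 := funext fun t => hconst t 0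
  have h3 := hγ.deriv_deriv_comp hf t
  rw [h2, deriv_const] at h3
  exact h1.ne h3

/-- A Riemannian manifold with a strictly convex function has no closed minimal submanifolds of
positive dimension. -/
theorem not_isMinimalImmersion_of_hessian_pos {d : ℕ} [NeZero d] {S : Type*} [TopologicalSpace S]
    [ChartedSpace (EuclideanSpace ℝ (Fin d)) S] [IsManifold (𝓡 d) ∞ S] [CompactSpace S]
    [Nonempty S] {h : BilinField k N}
    (hs : ∀ (x : N) (u v : TangentSpace (𝓡 k) x), h x u v = h x v u)
    (hh : IsPositiveDefinite h) {f : N → ℝ} (hf : ContMDiff (𝓡 k) 𝓘(ℝ, ℝ) ∞ f)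
    (hpos : ∀ (x : N) (u : TangentSpace (𝓡 k) x), u ≠ 0 → 0 < hessian h f x u u) (j : S → N) :
    ¬ IsMinimalImmersion (d := d) h j := by
  intro hj
  have hfj : ContMDiff (𝓡 d) 𝓘(ℝ, ℝ) ∞ (f ∘ j) := hf.comp hj.contMDiff
  obtain ⟨s, -, hmax⟩ := isCompact_univ.exists_isMaxOn univ_nonempty
    hfj.continuous.continuousOn
  have hmax' : IsLocalMax ((f ∘ j) ∘ (extChartAt (𝓡 d) s).symm) (extChartAt (𝓡 d) s s) :=
    Filter.Eventually.of_forall fun y => by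
      simp only [Function.comp_apply, extChartAt_to_inv]
      exact hmax (mem_univ _)
  set df := fderiv ℝ (f ∘ (extChartAt (𝓡 k) (j s)).symm) (extChartAt (𝓡 k) (j s) (j s)) with hdf
  let b : EuclideanSpace ℝ (Fin k) →L[ℝ] EuclideanSpace ℝ (Fin k) →L[ℝ] ℝ := h (j s)
  have hb : b.IsInvertible := isInvertible_of_posDef b (hh (j s))
  -- `b.inverse df` is the gradient of `f` at the maximum point; it is normal to `S` because the
  -- differential of `f ∘ j` vanishes there.
  have hν : ∀ w, b (b.inverse df) w = df w := fun w =>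
    DFunLike.congr_fun (hb.self_apply_inverse df) w
  have hnormal : IsNormal (k := d) h j s (b.inverse df) := fun u => by
    refine (hν _).trans ?_
    have h1 := fderiv_comp_extChartAt_symm (k := d) (m := k) hj.contMDiff hf s u
    rw [hmax'.fderiv_eq_zero] at h1
    exact h1.symm
  have hinj := hj.injective_mfderiv s
  have hne : ∀ u : EuclideanSpace ℝ (Fin d), u ≠ 0 → mfderiv (𝓡 d) (𝓡 k) j s u ≠ 0 :=
    fun u hu h0 => hu (hinj (h0.trans (map_zero _).symm))
  refine (metricTrace_neg_of_negDef (V := EuclideanSpace ℝ (Fin d))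
    (k := pullback (k := d) h j s) (B := secondFundamentalForm (k := d) h j s (b.inverse df))
    (fun u v => hs _ _ _) (fun u hu => hh _ _ (hne u hu)) fun u hu => ?_).ne
    (hj.minimal s _ hnormal)
  -- Pairing the gradient with `∇_u (dj u)` is applying `df` to it, so the second fundamental form
  -- equals a nonpositive second derivative minus a positive Hessian.
  have h1 := fderiv_fderiv_comp_extChartAt_symm (k := d) (m := k) h hj.contMDiff hf s u u
  have h2 := fderiv_fderiv_nonpos_of_isLocalMax
    ((contDiffAt_comp_extChartAt_symm hfj s).of_le two_le_infty) hmax' u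
  have h3 := hpos (j s) _ (hne u hu)
  have h4 : secondFundamentalForm (k := d) h j s (b.inverse df) u u =
    df (covDerivDifferential (k := d) h j s u u) := hν _
  erw [h4]
  rw [h1] at h2
  linarith

end ConvexFunctions

/-! ### Time-symmetric hypersurfaces are totally geodesic -/

section TimeSymmetric

variable {n : ℕ} {M : Type*} [TopologicalSpace M]
  [ChartedSpace (EuclideanSpace ℝ (Fin (n + 1))) M] [IsManifold (𝓡 (n + 1)) ∞ M]
  {N : Type*} [TopologicalSpace N] [ChartedSpace (EuclideanSpace ℝ (Fin n)) N]
  [IsManifold (𝓡 n) ∞ N]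
  {g : BilinField (n + 1) M} {ι : N → M}

/-- A time-symmetric spacelike hypersurface is totally geodesic. -/
theorem IsTimeSymmetric.covDerivDifferential_eq (hg : IsLorentzianMetric g)
    (hι : IsSpacelikeEmbedding (k := n) g ι) (hK : IsTimeSymmetric (k := n) g ι) (x : N)
    (u v : EuclideanSpace ℝ (Fin n)) :
    covDerivDifferential (k := n) g ι x u v =
      mfderiv (𝓡 n) (𝓡 (n + 1)) ι x (christoffel (pullback (k := n) g ι) x u v) := by
  have hpos := hι.isPositiveDefinite x
  have hsig : HasLorentzianSignature (V := EuclideanSpace ℝ (Fin (n + 1))) (g (ι x)) :=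
    hg.signature (ι x)
  have hnd : ∀ w : EuclideanSpace ℝ (Fin n), (∀ v, pullback (k := n) g ι x w v = 0) → w = 0 :=
    fun w hw => by
      by_contra h
      exact (hpos w h).ne' (hw w)
  -- `K = 0` removes the normal component, so the covariant derivative is `dι z`; the Gauss formula
  -- and nondegeneracy of the induced metric then determine `z`.
  obtain ⟨z, hz⟩ := mem_range_of_orthogonal_unit_normals (W := EuclideanSpace ℝ (Fin n)) hsig
    (hg.symm (ι x))
    (mfderiv (𝓡 n) (𝓡 (n + 1)) ι x :
      EuclideanSpace ℝ (Fin n) →L[ℝ] EuclideanSpace ℝ (Fin (n + 1))) (by simp) hpos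
    (covDerivDifferential (k := n) g ι x u v) (fun t ht htt =>
      DFunLike.congr_fun (DFunLike.congr_fun (hK x t ht htt) u) v)
  have hΓ : ∀ w, pullback (k := n) g ι x (christoffel (pullback (k := n) g ι) x u v) w =
      pullback (k := n) g ι x z w := fun w => by
    have h1 := apply_christoffel_pullback hι.isSmoothEmbedding.contMDiff x
      (hg.differentiableAt_metricInChart (ι x)) (hg.symm (ι x))
      (hsig.nondegenerate (hg.symm (ι x))) hnd u v w
    rw [hz] at h1
    exact h1
  have h2 : christoffel (pullback (k := n) g ι) x u v - z = 0 := hnd _ fun w => by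
    have := hΓ w
    erw [map_sub, sub_apply, this, sub_self]
  rw [hz, sub_eq_zero.mp h2]
  rfl

/-- In general the two sides differ by `df` of the normal part of `∇_u (dι v)`; total geodesy makes
this vanish. -/
theorem IsTimeSymmetric.hessian_pullback (hg : IsLorentzianMetric g)
    (hι : IsSpacelikeEmbedding (k := n) g ι) (hK : IsTimeSymmetric (k := n) g ι) {f : M → ℝ}
    (hf : ContMDiff (𝓡 (n + 1)) 𝓘(ℝ, ℝ) ∞ f) (x : N) (u v : EuclideanSpace ℝ (Fin n)) :
    hessian (pullback (k := n) g ι) (f ∘ ι) x u v =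
      hessian g f (ι x) (mfderiv (𝓡 n) (𝓡 (n + 1)) ι x u) (mfderiv (𝓡 n) (𝓡 (n + 1)) ι x v) := by
  have hsm := hι.isSmoothEmbedding.contMDiff
  have h1 := hessian_apply (pullback (k := n) g ι) (f ∘ ι) x u v
  rw [fderiv_fderiv_comp_extChartAt_symm (k := n) (m := n + 1) g hsm hf,
    fderiv_comp_extChartAt_symm (k := n) (m := n + 1) hsm hf,
    hK.covDerivDifferential_eq hg hι] at h1
  exact h1.trans (add_sub_cancel_right _ _)

end TimeSymmetric

end SpacetimeConvexity

end

/-! ### The theorem -/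

theorem mainTheorem12 {n : ℕ}
    {M : Type*} [TopologicalSpace M] [ChartedSpace (EuclideanSpace ℝ (Fin (n + 1))) M]
    [IsManifold (𝓡 (n + 1)) ∞ M]
    (g : SpacetimeConvexity.BilinField (n + 1) M)
    (hg : SpacetimeConvexity.IsLorentzianMetric g)
    (f : M → ℝ) (hf : SpacetimeConvexity.IsSpacetimeConvex g f)
    {N : Type*} [TopologicalSpace N] [ChartedSpace (EuclideanSpace ℝ (Fin n)) N]
    [IsManifold (𝓡 n) ∞ N]
    (ι : N → M) (hι : SpacetimeConvexity.IsSpacelikeEmbedding (k := n) g ι)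
    (hK : SpacetimeConvexity.IsTimeSymmetric (k := n) g ι) :
    (¬ ∃ γ : ℝ → N,
      SpacetimeConvexity.IsClosedGeodesic (SpacetimeConvexity.pullback (k := n) g ι) γ) ∧
    (∀ (S : Type*) [TopologicalSpace S] [ChartedSpace (EuclideanSpace ℝ (Fin 2)) S]
      [IsManifold (𝓡 2) ∞ S] [CompactSpace S] [Nonempty S],
      ¬ ∃ j : S → N,
        SpacetimeConvexity.IsMinimalImmersion (d := 2)
          (SpacetimeConvexity.pullback (k := n) g ι) j) := by
  have hsm : ContMDiff (𝓡 n) (𝓡 (n + 1)) ∞ ι := hι.isSmoothEmbedding.contMDiff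
  have hfι : ContMDiff (𝓡 n) 𝓘(ℝ, ℝ) ∞ (f ∘ ι) := hf.contMDiff.comp hsm
  obtain ⟨c, hc, hbound⟩ := hf.bound
  -- Strict convexity of `f ∘ ι`: its Hessian is bounded below by `c` times the induced metric.
  have hpos : ∀ (x : N) (u : TangentSpace (𝓡 n) x), u ≠ 0 →
      0 < SpacetimeConvexity.hessian (SpacetimeConvexity.pullback (k := n) g ι) (f ∘ ι) x u u :=
    fun x u hu =>
      (mul_pos hc (hι.isPositiveDefinite x u hu)).trans_le
        ((hbound (ι x) _).trans_eq (hK.hessian_pullback hg hι hf.contMDiff x u u).symm)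
  refine ⟨fun ⟨γ, hγ⟩ =>
    SpacetimeConvexity.not_isClosedGeodesic_of_hessian_pos hfι hpos γ hγ, ?_⟩
  intro S _ _ _ _ _ ⟨j, hj⟩
  exact SpacetimeConvexity.not_isMinimalImmersion_of_hessian_pos
    (h := SpacetimeConvexity.pullback (k := n) g ι) (fun x u v => hg.symm (ι x) _ _)
    hι.isPositiveDefinite hfι hpos j hj
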